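/- Let $\mathcal X$ be a measurable space and let $(Y,X,p,G)$ be random variables on a probability space with values in $\mathbb R\times\mathcal X\times[0,1]\times\{0,1\}$, where $G$ is a latent (unobserved) group indicator. Assume $\mathbb E[Y^4]<\infty$ and $\mathbb E[p^4]<\infty$; let $m(x)=\mathbb E[Y\mid X=x]$ and $r(x)=\mathbb E[p\mid X=x]$ (measurable versions), and put $V^*=\mathbb E[(p-r(X))^2]$. Assume that, for some $\tau\in\mathbb R$: (i) there is a measurable function $\mu:\mathcal X\to\mathbb R$ with $\mathbb E[Y\mid G,p,X]=\mu(X)+\tau G$ almost surely; (ii) $\mathbb E[G\mid p,X]=p$ almost surely; (iii) $V^*>0$. Let $(Y_i,X_i,p_i)$, $i\ge 1$, be i.i.d. copies of $(Y,X,p)$, and let $$\hat\tau_{\mathrm{or}}=\hat\tau_{\mathrm{or},n}=\frac{\frac1n\sum_{i=1}^n(2p_i-1)(Y_i-m(X_i))}{2\,\frac1n\sum_{i=1}^n(p_i-r(X_i))^2}$$ be the oracle estimator, which uses the true functions $m$ and $r$ (with value $0$ if the denominator vanishes). Let $\psi=(2p-1)(Y-m(X))-2\tau(p-r(X))^2$.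 Then $\mathbb E[\psi]=0$, $\mathbb E[\psi^2]<\infty$, and, as $n\to\infty$, $$\sqrt n\,(\hat\tau_{\mathrm{or}}-\tau)\ \xrightarrow{\ d\ }\ \mathcal N\!\left(0,\ \frac{\mathbb E[\psi^2]}{(2V^*)^2}\right),$$ where $\mathcal N(0,0)$ denotes the point mass at $0$. -/

import Mathlib

open MeasureTheory ProbabilityTheory Filter

noncomputable section

namespace LatentGroup

variable {Ω 𝒳 : Type*} [MeasurableSpace Ω] [MeasurableSpace 𝒳]

/-- `f` is a version of the regression function `x ↦ E[W | X = x]`: a measurable function on the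
covariate space with `f(X) = E[W | σ(X)]` almost surely. -/
def IsRegressionFunction (P : Measure Ω) (W : Ω → ℝ) (X : Ω → 𝒳) (f : 𝒳 → ℝ) : Prop :=
  Measurable f ∧
    (fun ω => f (X ω)) =ᵐ[P] P[W | MeasurableSpace.comap X inferInstance]

/-- Structural conditional mean: for some measurable `μ`,
`E[Y | G, p, X] = μ(X) + τ G` almost surely. -/
def StructuralMean (P : Measure Ω) (Y : Ω → ℝ) (X : Ω → 𝒳) (p G : Ω → ℝ) (τ : ℝ) : Prop :=
  ∃ μ : 𝒳 → ℝ, Measurable μ ∧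
    P[Y | MeasurableSpace.comap (fun ω => (G ω, p ω, X ω)) inferInstance]
      =ᵐ[P] fun ω => μ (X ω) + τ * G ω

/-- Conditional calibration: `E[G | p, X] = p` almost surely. -/
def Calibrated (P : Measure Ω) (X : Ω → 𝒳) (p G : Ω → ℝ) : Prop :=
  P[G | MeasurableSpace.comap (fun ω => (p ω, X ω)) inferInstance] =ᵐ[P] p

/-- The residual score variance `V* = E[(p - r(X))²]`. -/
def residualScoreVariance (P : Measure Ω) (X : Ω → 𝒳) (p : Ω → ℝ) (r : 𝒳 → ℝ) : ℝ :=
  ∫ ω, (p ω - r (X ω)) ^ 2 ∂P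

/-- The score `ψ = (2p - 1)(Y - m(X)) - 2τ(p - r(X))²` at the parameter `τ`. -/
def score (m r : 𝒳 → ℝ) (τ : ℝ) (Y : Ω → ℝ) (X : Ω → 𝒳) (p : Ω → ℝ) (ω : Ω) : ℝ :=
  (2 * p ω - 1) * (Y ω - m (X ω)) - 2 * τ * (p ω - r (X ω)) ^ 2

/-- The oracle ratio estimator computed from the first `n` observations
(with value `0` if its denominator vanishes). -/
def oracleEstimator (m r : 𝒳 → ℝ) (Ys : ℕ → Ω → ℝ) (Xs : ℕ → Ω → 𝒳) (ps : ℕ → Ω → ℝ)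
    (n : ℕ) (ω : Ω) : ℝ :=
  ((1 / (n : ℝ)) * ∑ i ∈ Finset.range n, (2 * ps i ω - 1) * (Ys i ω - m (Xs i ω))) /
    (2 * ((1 / (n : ℝ)) * ∑ i ∈ Finset.range n, (ps i ω - r (Xs i ω)) ^ 2))

end LatentGroup

end

/-! Conditioning the structural equation on `(p, X)`, calibration turns `G` into `p`; conditioning
again on `X` turns `p` into `r(X)`. Subtracting removes the unknown `μ`: `E[Y - m(X) | p, X] = τ (p
- r(X))` (`condExp_eq_add_mul_residual`). Multiply by `2p - 1 = 2(p - r(X)) + (2r(X) - 1)`; the last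
term is orthogonal to `p - r(X)`, so `E[ψ] = 0` (`integral_score_eq_zero`). The estimator is a ratio
of sample means whose error is the mean of the `ψᵢ` over the mean of `2(pᵢ - r(Xᵢ))²`. The central
limit theorem, the law of large numbers and Slutsky's lemma conclude
(`tendstoInDistribution_sqrt_mul_ratio_sub`). -/

/-! ### Conditional expectations, and asymptotics of ratios of sample means. -/

/-- The law of total expectation with a bounded factor that is known given `m`. -/
theorem integral_mul_condExp_of_bound {Ω : Type*} {m mΩ : MeasurableSpace Ω} {P : Measure Ω}
    [IsFiniteMeasure P] (hm : m ≤ mΩ) {f g : Ω → ℝ} (hf : StronglyMeasurable[m] f)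
    (hg : Integrable g P) (c : ℝ) (hc : ∀ᵐ ω ∂P, ‖f ω‖ ≤ c) :
    ∫ ω, f ω * g ω ∂P = ∫ ω, f ω * (P[g | m]) ω ∂P := by
  rw [← integral_condExp hm]
  exact integral_congr_ae (condExp_stronglyMeasurable_mul_of_bound hm hf hg c hc)

theorem memLp_two_of_integrable_pow_four {Ω : Type*} {mΩ : MeasurableSpace Ω} {P : Measure Ω}
    [IsFiniteMeasure P] {f : Ω → ℝ} (hf : AEStronglyMeasurable f P)
    (h : Integrable (fun ω => f ω ^ 4) P) : MemLp f 2 P := by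
  rw [memLp_two_iff_integrable_sq hf]
  refine ((integrable_const (1 : ℝ)).add h).mono' (hf.pow 2) (.of_forall fun ω => ?_)
  rw [Real.norm_eq_abs, abs_of_nonneg (sq_nonneg _)]
  simp only [Pi.add_apply]
  nlinarith [sq_nonneg (f ω ^ 2 - 1), sq_nonneg (f ω ^ 2)]

theorem condExp_sub_of_stronglyMeasurable {Ω : Type*} {m mΩ : MeasurableSpace Ω} {P : Measure Ω}
    [IsFiniteMeasure P] (hm : m ≤ mΩ) {f g : Ω → ℝ} (hg : Integrable g P)
    (hf : StronglyMeasurable[m] f) (hfint : Integrable f P) :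
    P[fun ω => g ω - f ω | m] =ᵐ[P] fun ω => (P[g | m]) ω - f ω := by
  have h := condExp_sub hg hfint m
  rw [condExp_of_stronglyMeasurable hm hf hfint] at h
  exact h

/-- **Central limit theorem for ratios of sample means**: if the pairs `(Uᵢ, Vᵢ)` are i.i.d. with
`E[U] = θ E[V]` and `E[V] ≠ 0`, then the ratio of sample means is asymptotically normal
around `θ`. -/
theorem tendstoInDistribution_sqrt_mul_ratio_sub {Ω : Type*} {mΩ : MeasurableSpace Ω}
    {P : Measure Ω} [IsProbabilityMeasure P] {U V : ℕ → Ω → ℝ} {θ : ℝ}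
    (hindep : iIndepFun (fun i ω => (U i ω, V i ω)) P)
    (hident : ∀ i, IdentDistrib (fun ω => (U i ω, V i ω)) (fun ω => (U 0 ω, V 0 ω)) P P)
    (hV : Integrable (V 0) P) (hV0 : ∫ ω, V 0 ω ∂P ≠ 0)
    (hZ : MemLp (fun ω => U 0 ω - θ * V 0 ω) 2 P) (hZ0 : ∫ ω, (U 0 ω - θ * V 0 ω) ∂P = 0) :
    TendstoInDistribution
      (fun (n : ℕ) ω => Real.sqrt n * (((1 / (n : ℝ)) * ∑ i ∈ Finset.range n, U i ω) /
        ((1 / (n : ℝ)) * ∑ i ∈ Finset.range n, V i ω) - θ))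
      atTop (id : ℝ → ℝ) (fun _ => P)
      (gaussianReal 0 (Real.toNNReal
        ((∫ ω, (U 0 ω - θ * V 0 ω) ^ 2 ∂P) / (∫ ω, V 0 ω ∂P) ^ 2))) := by
  set v : ℝ := ∫ ω, V 0 ω ∂P with hv
  set s : ℝ := ∫ ω, (U 0 ω - θ * V 0 ω) ^ 2 ∂P with hs
  have hs0 : 0 ≤ s := integral_nonneg fun ω => sq_nonneg _
  have hφ : Measurable fun x : ℝ × ℝ => x.1 - θ * x.2 := by fun_prop
  have hUm i : AEMeasurable (U i) P := ((hident i).comp measurable_fst).aemeasurable_fst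
  have hVm i : AEMeasurable (V i) P := ((hident i).comp measurable_snd).aemeasurable_fst
  have hvar : Var[fun ω => U 0 ω - θ * V 0 ω; P] = s := by
    rw [variance_of_integral_eq_zero hZ.aestronglyMeasurable.aemeasurable hZ0]
  -- The limit in the central limit theorem is represented as `v * x` with `x` of the target law, so
  -- that Slutsky's division by `v` leaves `id`.
  have hlaw : HasLaw (fun x : ℝ => v * x)
      (gaussianReal 0 (Var[fun ω => U 0 ω - θ * V 0 ω; P]).toNNReal)
      (gaussianReal 0 (Real.toNNReal (s / v ^ 2))) := by
    convert gaussianReal_const_mul (HasLaw.id (μ := gaussianReal 0 (Real.toNNReal (s / v ^ 2)))) v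
      using 2
    · rfl
    · rw [mul_zero]
    · refine NNReal.coe_injective ?_
      rw [hvar, NNReal.coe_mul, Real.coe_toNNReal _ hs0, Real.coe_toNNReal _ (by positivity)]
      simp only [NNReal.coe_mk]
      field_simp
  have hclt := tendstoInDistribution_inv_sqrt_mul_sum_sub
    (X := fun i ω => U i ω - θ * V i ω) hlaw hZ
    (hindep.comp (fun _ x => x.1 - θ * x.2) fun _ => hφ)
    (fun i => (hident i).comp hφ)
  simp only [hZ0, mul_zero, sub_zero] at hclt
  have hlln := strong_law_ae_real V hV
    (fun i j hij => (hindep.indepFun hij).comp measurable_snd measurable_snd)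
    (fun i => (hident i).comp measurable_snd)
  have hmeanV (n : ℕ) : AEMeasurable (fun ω => ((∑ i ∈ Finset.range n, V i ω) / n)⁻¹) P :=
    ((Finset.aemeasurable_fun_sum _ fun i _ => hVm i).div_const _).inv
  have hinv : TendstoInMeasure P (fun (n : ℕ) ω => ((∑ i ∈ Finset.range n, V i ω) / n)⁻¹) atTop
      (fun _ => v⁻¹) := by
    refine tendstoInMeasure_of_tendsto_ae (fun n => (hmeanV n).aestronglyMeasurable) ?_
    filter_upwards [hlln] with ω hω using hω.inv₀ hV0
  have hprod := hclt.continuous_comp_prodMk_of_tendstoInMeasure_const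
    (g := fun x : ℝ × ℝ => x.1 * x.2) (by fun_prop) hinv hmeanV
  have hlim : (fun x : ℝ => v * x * v⁻¹) = id := by
    ext x
    simp only [id_eq]
    field_simp
  rw [hlim] at hprod
  have hmeas (n : ℕ) : AEMeasurable (fun ω => Real.sqrt n *
      (((1 / (n : ℝ)) * ∑ i ∈ Finset.range n, U i ω) /
        ((1 / (n : ℝ)) * ∑ i ∈ Finset.range n, V i ω) - θ)) P :=
    ((((Finset.aemeasurable_fun_sum _ fun i _ => hUm i).const_mul _).div
      ((Finset.aemeasurable_fun_sum _ fun i _ => hVm i).const_mul _)).sub_const _).const_mul _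
  -- The Slutsky product equals the scaled error once `n > 0` and the mean of the `Vᵢ` is nonzero,
  -- which almost surely holds eventually.
  refine tendstoInDistribution_of_tendstoInMeasure_sub _ _ hprod ?_ hmeas
  refine tendstoInMeasure_of_tendsto_ae
    (fun n => ((hmeas n).sub (hprod.forall_aemeasurable n)).aestronglyMeasurable) ?_
  filter_upwards [hlln] with ω hω
  refine tendsto_const_nhds.congr' ?_
  filter_upwards [hω.eventually_ne hV0, eventually_gt_atTop 0] with n hn hn0
  have hn' : (0 : ℝ) < n := by exact_mod_cast hn0
  have hsum : ∑ i ∈ Finset.range n, V i ω ≠ 0 := fun h => hn (by simp [h])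
  have hsq : Real.sqrt n ≠ 0 := (Real.sqrt_pos.2 hn').ne'
  simp only [Pi.zero_apply, Pi.sub_apply, Finset.sum_sub_distrib, ← Finset.mul_sum]
  field_simp
  rw [Real.sq_sqrt hn'.le]
  ring

/-! ### Moments of the score. -/

namespace LatentGroup

variable {Ω 𝒳 : Type*} [mΩ : MeasurableSpace Ω] [MeasurableSpace 𝒳] {P : Measure Ω}
  {Y p G : Ω → ℝ} {X : Ω → 𝒳} {m r : 𝒳 → ℝ} {τ : ℝ}

theorem IsRegressionFunction.memLp [IsProbabilityMeasure P] {q : ENNReal} (hq : 1 ≤ q)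
    (h : IsRegressionFunction P Y X m) (hY : MemLp Y q P) : MemLp (fun ω => m (X ω)) q P :=
  (memLp_congr_ae h.2).2 (hY.condExp hq)

/-- Under calibration, the conditional mean of the outcome given the score and the covariates
is linear in the residual score, with slope `τ`. -/
theorem condExp_eq_add_mul_residual [IsProbabilityMeasure P] (hX : Measurable X)
    (hp : Measurable p) (hG : Measurable G) (hpint : Integrable p P)
    (hGint : Integrable G P) (hm : IsRegressionFunction P Y X m)
    (hr : IsRegressionFunction P p X r) (hmean : StructuralMean P Y X p G τ)
    (hcal : Calibrated P X p G) :
    P[Y | MeasurableSpace.comap (fun ω => (p ω, X ω)) inferInstance]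
      =ᵐ[P] fun ω => m (X ω) + τ * (p ω - r (X ω)) := by
  obtain ⟨μ, hμ, hYG⟩ := hmean
  set σX : MeasurableSpace Ω := MeasurableSpace.comap X inferInstance with hσX
  set σpX : MeasurableSpace Ω := MeasurableSpace.comap (fun ω => (p ω, X ω)) inferInstance
    with hσpX
  set σGpX : MeasurableSpace Ω :=
    MeasurableSpace.comap (fun ω => (G ω, p ω, X ω)) inferInstance with hσGpX
  have hle : σGpX ≤ mΩ := (hG.prodMk (hp.prodMk hX)).comap_le
  have hpXG : σpX ≤ σGpX := by
    have : Measurable[σGpX] fun ω => (p ω, X ω) :=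
      measurable_snd.comp (comap_measurable fun ω => (G ω, p ω, X ω))
    exact this.comap_le
  have hXpX : σX ≤ σpX := by
    have : Measurable[σpX] X := measurable_snd.comp (comap_measurable fun ω => (p ω, X ω))
    exact this.comap_le
  have hμX : StronglyMeasurable[σX] fun ω => μ (X ω) :=
    (hμ.comp (comap_measurable X)).stronglyMeasurable
  -- Integrability of `μ(X)` is not assumed: it comes from `μ(X) = E[Y | G, p, X] - τ G`.
  have hμint : Integrable (fun ω => μ (X ω)) P := by
    refine ((integrable_condExp (m := σGpX) (μ := P) (f := Y)).sub (hGint.const_mul τ)).congr ?_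
    filter_upwards [hYG] with ω hω
    simp [hω]
  have hlin {m₀ : MeasurableSpace Ω} (hm₀ : m₀ ≤ mΩ) (hX₀ : σX ≤ m₀)
      {W : Ω → ℝ} (hW : Integrable W P) :
      P[fun ω => μ (X ω) + τ * W ω | m₀] =ᵐ[P] fun ω => μ (X ω) + τ * (P[W | m₀]) ω := by
    have h1 := condExp_add hμint (hW.const_mul τ) m₀
    have h2 := condExp_smul τ W m₀ (μ := P)
    rw [condExp_of_stronglyMeasurable hm₀ (hμX.mono hX₀) hμint] at h1
    filter_upwards [h1, h2] with ω h1 h2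
    exact h1.trans (congrArg (μ (X ω) + ·) h2)
  have hYpX : P[Y | σpX] =ᵐ[P] fun ω => μ (X ω) + τ * p ω := by
    refine (condExp_condExp_of_le hpXG hle).symm.trans ((condExp_congr_ae hYG).trans ?_)
    filter_upwards [hlin (hpXG.trans hle) hXpX hGint, hcal] with ω h1 h2
    rw [h1, h2]
  have hYX : P[Y | σX] =ᵐ[P] fun ω => μ (X ω) + τ * r (X ω) := by
    refine (condExp_condExp_of_le hXpX (hpXG.trans hle)).symm.trans
      ((condExp_congr_ae hYpX).trans ?_)
    filter_upwards [hlin hX.comap_le le_rfl hpint, hr.2] with ω h1 h2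
    rw [h1, h2]
  filter_upwards [hYpX, hYX, hm.2] with ω h1 h2 h3
  rw [h1, h3, h2]
  ring

/-- The bound `|p| ≤ 1` passes to its conditional expectation `r(X)`. -/
theorem ae_abs_residual_le_two [IsProbabilityMeasure P]
    (hp01 : ∀ᵐ ω ∂P, p ω ∈ Set.Icc (0 : ℝ) 1) (hr : IsRegressionFunction P p X r) :
    ∀ᵐ ω ∂P, |p ω - r (X ω)| ≤ 2 := by
  have hp1 : ∀ᵐ ω ∂P, |p ω| ≤ 1 := by
    filter_upwards [hp01] with ω hω
    simpa [abs_of_nonneg hω.1] using hω.2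
  filter_upwards [hp1, ae_bdd_abs_condExp_of_ae_bdd_abs hp1, hr.2] with ω h1 h2 h3
  rw [← h3] at h2
  rw [abs_le] at *
  constructor <;> linarith

/-- Since `|2p - 1| ≤ 1` and `p - r(X)` is bounded, a second moment of `Y` suffices. -/
theorem memLp_score [IsProbabilityMeasure P] (hX : Measurable X) (hp : Measurable p)
    (hp01 : ∀ᵐ ω ∂P, p ω ∈ Set.Icc (0 : ℝ) 1) (hY2 : MemLp Y 2 P)
    (hm : IsRegressionFunction P Y X m) (hr : IsRegressionFunction P p X r) :
    MemLp (score m r τ Y X p) 2 P := by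
  have hrX : Measurable fun ω => r (X ω) := hr.1.comp hX
  have h1 : MemLp (fun ω => (2 * p ω - 1) * (Y ω - m (X ω))) 2 P := by
    have hres := hY2.sub (hm.memLp one_le_two hY2)
    refine hres.of_le
      (((hp.const_mul 2).sub_const 1).aestronglyMeasurable.mul hres.aestronglyMeasurable) ?_
    filter_upwards [hp01] with ω hω
    rw [norm_mul]
    refine mul_le_of_le_one_left (norm_nonneg _) ?_
    rw [Real.norm_eq_abs, abs_le]
    constructor <;> linarith [hω.1, hω.2]
  have h2 : MemLp (fun ω => (p ω - r (X ω)) ^ 2) 2 P := by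
    refine .of_bound ((hp.sub hrX).pow_const 2).aestronglyMeasurable 4 ?_
    filter_upwards [ae_abs_residual_le_two hp01 hr] with ω hω
    rw [norm_pow, Real.norm_eq_abs]
    nlinarith [abs_nonneg (p ω - r (X ω))]
  exact h1.sub (h2.const_mul (2 * τ))

theorem integral_score_eq_zero [IsProbabilityMeasure P] (hX : Measurable X) (hp : Measurable p)
    (hG : Measurable G) (hp01 : ∀ᵐ ω ∂P, p ω ∈ Set.Icc (0 : ℝ) 1) (hGint : Integrable G P)
    (hYint : Integrable Y P) (hm : IsRegressionFunction P Y X m)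
    (hr : IsRegressionFunction P p X r) (hmean : StructuralMean P Y X p G τ)
    (hcal : Calibrated P X p G) :
    ∫ ω, score m r τ Y X p ω ∂P = 0 := by
  have hrX : Measurable fun ω => r (X ω) := hr.1.comp hX
  have hpint : Integrable p P := by
    refine .of_bound hp.aestronglyMeasurable 1 ?_
    filter_upwards [hp01] with ω hω
    rw [Real.norm_eq_abs, abs_of_nonneg hω.1]
    exact hω.2
  have hmint : Integrable (fun ω => m (X ω)) P := integrable_condExp.congr hm.2.symm
  have hrint : Integrable (fun ω => r (X ω)) P := integrable_condExp.congr hr.2.symm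
  have hres2 : Integrable (fun ω => (p ω - r (X ω)) ^ 2) P := by
    refine .of_bound ((hp.sub hrX).pow_const 2).aestronglyMeasurable 4 ?_
    filter_upwards [ae_abs_residual_le_two hp01 hr] with ω hω
    rw [norm_pow, Real.norm_eq_abs]
    nlinarith [abs_nonneg (p ω - r (X ω))]
  -- Any constant serves; `|p - r(X)| ≤ 2` and `0 ≤ p ≤ 1` already give `5`.
  have hr1 : ∀ᵐ ω ∂P, ‖2 * r (X ω) - 1‖ ≤ 7 := by
    filter_upwards [ae_abs_residual_le_two hp01 hr, hp01] with ω hω h01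
    rw [Real.norm_eq_abs, abs_le]
    rw [abs_le] at hω
    constructor <;> linarith [h01.1, h01.2]
  have hX1 : ∫ ω, (2 * r (X ω) - 1) * (p ω - r (X ω)) ∂P = 0 := by
    rw [integral_mul_condExp_of_bound hX.comap_le
      (f := fun ω => 2 * r (X ω) - 1) (g := fun ω => p ω - r (X ω))
      (((hr.1.comp (comap_measurable X)).const_mul 2).sub_const 1).stronglyMeasurable
      (hpint.sub hrint) 7 hr1]
    refine integral_eq_zero_of_ae ?_
    filter_upwards [condExp_sub_of_stronglyMeasurable hX.comap_le hpint
      (hr.1.comp (comap_measurable X)).stronglyMeasurable hrint, hr.2] with ω h1 h2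
    simp only [Function.comp_apply] at h1
    rw [h1, ← h2]
    simp
  have hp1 : ∀ᵐ ω ∂P, ‖2 * p ω - 1‖ ≤ 1 := by
    filter_upwards [hp01] with ω hω
    rw [Real.norm_eq_abs, abs_le]
    constructor <;> linarith [hω.1, hω.2]
  have hbd (W : Ω → ℝ) (hW : Integrable W P) : Integrable (fun ω => (2 * p ω - 1) * W ω) P :=
    hW.bdd_mul ((hp.const_mul 2).sub_const 1).aestronglyMeasurable hp1
  have hY1 : ∫ ω, (2 * p ω - 1) * (Y ω - m (X ω)) ∂P
      = ∫ ω, (2 * p ω - 1) * (τ * (p ω - r (X ω))) ∂P := by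
    have hreg := condExp_eq_add_mul_residual hX hp hG hpint hGint hm hr hmean hcal
    let σpX : MeasurableSpace Ω := MeasurableSpace.comap (fun ω => (p ω, X ω)) inferInstance
    have hpX : Measurable[σpX] fun ω => (p ω, X ω) := comap_measurable _
    have hpXle : σpX ≤ mΩ := (hp.prodMk hX).comap_le
    have hpm : Measurable[σpX] p := measurable_fst.comp hpX
    have hXm : Measurable[σpX] X := measurable_snd.comp hpX
    rw [integral_mul_condExp_of_bound hpXle
      (f := fun ω => 2 * p ω - 1) (g := fun ω => Y ω - m (X ω))
      ((hpm.const_mul 2).sub_const 1).stronglyMeasurable (hYint.sub hmint) 1 hp1]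
    refine integral_congr_ae ?_
    filter_upwards [condExp_sub_of_stronglyMeasurable hpXle hYint
      (hm.1.comp hXm).stronglyMeasurable hmint,
      hreg] with ω h1 h2
    simp only [Function.comp_apply] at h1
    rw [h1, h2]
    ring
  simp only [score]
  rw [integral_sub (hbd (fun ω => Y ω - m (X ω)) (hYint.sub hmint)) (hres2.const_mul _), hY1,
    ← integral_sub (hbd (fun ω => τ * (p ω - r (X ω))) ((hpint.sub hrint).const_mul τ))
      (hres2.const_mul _)]
  -- The part `2(p - r(X))` of `2p - 1` cancels the quadratic term of the score.
  calc _ = ∫ ω, τ * ((2 * r (X ω) - 1) * (p ω - r (X ω))) ∂P := by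
        congr 1 with ω
        ring
    _ = 0 := by rw [integral_const_mul, hX1, mul_zero]

end LatentGroup

/-! ### Transfer from the population to the sample. -/

theorem theorem2 {Ω Ω' 𝒳 : Type*} [MeasurableSpace Ω] [MeasurableSpace Ω'] [MeasurableSpace 𝒳]
    -- the population: a generic unit `(Y, X, p, G)` on a probability space `(Ω, P)`
    (P : Measure Ω) [IsProbabilityMeasure P]
    (Y : Ω → ℝ) (X : Ω → 𝒳) (p G : Ω → ℝ)
    (hY : Measurable Y) (hX : Measurable X) (hp : Measurable p) (hG : Measurable G)
    (hp01 : ∀ᵐ ω ∂P, p ω ∈ Set.Icc (0 : ℝ) 1) (hG01 : ∀ᵐ ω ∂P, G ω = 0 ∨ G ω = 1)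
    (m r : 𝒳 → ℝ) (τ : ℝ)
    (hm : LatentGroup.IsRegressionFunction P Y X m)
    (hr : LatentGroup.IsRegressionFunction P p X r)
    (hmean : LatentGroup.StructuralMean P Y X p G τ)
    (hcal : LatentGroup.Calibrated P X p G)
    (hvar : 0 < LatentGroup.residualScoreVariance P X p r)
    (hY4 : Integrable (fun ω => Y ω ^ 4) P) (hp4 : Integrable (fun ω => p ω ^ 4) P)
    -- the sample: independent draws from the joint law of `(Y, X, p)`
    (P' : Measure Ω') [IsProbabilityMeasure P']
    (Ys : ℕ → Ω' → ℝ) (Xs : ℕ → Ω' → 𝒳) (ps : ℕ → Ω' → ℝ)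
    (hindep : iIndepFun (fun i ω => (Ys i ω, Xs i ω, ps i ω)) P')
    (hident : ∀ i, IdentDistrib (fun ω => (Ys i ω, Xs i ω, ps i ω))
      (fun ω => (Y ω, X ω, p ω)) P' P) :
    (∫ ω, LatentGroup.score m r τ Y X p ω ∂P = 0) ∧
    Integrable (fun ω => LatentGroup.score m r τ Y X p ω ^ 2) P ∧
    TendstoInDistribution
      (fun (n : ℕ) (ω : Ω') =>
        Real.sqrt n * (LatentGroup.oracleEstimator m r Ys Xs ps n ω - τ))
      atTop (id : ℝ → ℝ) (fun _ => P')
      (gaussianReal 0 (Real.toNNReal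
        ((∫ ω, LatentGroup.score m r τ Y X p ω ^ 2 ∂P) /
          (2 * LatentGroup.residualScoreVariance P X p r) ^ 2))) := by
  have hY2 : MemLp Y 2 P := memLp_two_of_integrable_pow_four hY.aestronglyMeasurable hY4
  have hYint : Integrable Y P := hY2.integrable one_le_two
  have hGint : Integrable G P := by
    refine .of_bound hG.aestronglyMeasurable 1 ?_
    filter_upwards [hG01] with ω hω
    rcases hω with h | h <;> simp [h]
  have hψ2 := LatentGroup.memLp_score (τ := τ) hX hp hp01 hY2 hm hr
  have hψ0 := LatentGroup.integral_score_eq_zero hX hp hG hp01 hGint hYint hm hr hmean hcal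
  refine ⟨hψ0, hψ2.integrable_sq, ?_⟩
  let φ : ℝ × 𝒳 × ℝ → ℝ × ℝ := fun z =>
    ((2 * z.2.2 - 1) * (z.1 - m z.2.1), 2 * (z.2.2 - r z.2.1) ^ 2)
  have hφ : Measurable φ := by
    have := hm.1
    have := hr.1
    fun_prop
  let ζ : ℝ × ℝ → ℝ := fun x => x.1 - τ * x.2
  have hζ : Measurable ζ := by fun_prop
  have hφident i := (hident i).comp hφ
  have hζident := (hφident 0).comp hζ
  have hVident := (hφident 0).comp measurable_snd
  have hscore : ζ ∘ φ ∘ (fun ω => (Y ω, X ω, p ω)) = LatentGroup.score m r τ Y X p := by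
    ext ω
    simp only [ζ, φ, Function.comp_apply, LatentGroup.score]
    ring
  rw [hscore] at hζident
  have hres2 : Integrable (fun ω => 2 * (p ω - r (X ω)) ^ 2) P := by
    refine Integrable.const_mul ?_ 2
    -- The integral of a non-integrable function is `0` by convention, against `V* > 0`.
    by_contra h
    exact hvar.ne' (integral_undef h)
  have hmeanV : ∫ ω, 2 * (ps 0 ω - r (Xs 0 ω)) ^ 2 ∂P' =
      2 * LatentGroup.residualScoreVariance P X p r :=
    hVident.integral_eq.trans (integral_const_mul _ _)
  have hsq : ∫ ω, ((2 * ps 0 ω - 1) * (Ys 0 ω - m (Xs 0 ω)) -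
      τ * (2 * (ps 0 ω - r (Xs 0 ω)) ^ 2)) ^ 2 ∂P' =
      ∫ ω, LatentGroup.score m r τ Y X p ω ^ 2 ∂P :=
    hζident.sq.integral_eq
  have key := tendstoInDistribution_sqrt_mul_ratio_sub (P := P') (θ := τ)
    (U := fun i ω => (2 * ps i ω - 1) * (Ys i ω - m (Xs i ω)))
    (V := fun i ω => 2 * (ps i ω - r (Xs i ω)) ^ 2)
    (hindep.comp (fun _ => φ) fun _ => hφ)
    (fun i => (hφident i).trans (hφident 0).symm)
    (hVident.integrable_iff.2 hres2)
    (by rw [hmeanV]; positivity)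
    (hζident.memLp_iff.2 hψ2)
    (hζident.integral_eq.trans hψ0)
  rw! [hsq, hmeanV] at key
  convert key using 6 with n ω
  rw [LatentGroup.oracleEstimator, ← Finset.mul_sum]
  ring
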